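/- **Setting.** Let $X$ be a complex Banach space represented as the direct sum $X=X_1\oplus\dots\oplus X_n$ of closed nonzero subspaces (every $x\in X$ is uniquely $x=x_1+\dots+x_n$ with $x_i\in X_i$). A bounded operator $T\in B(X)$ is identified with its operator matrix $\{T_{ij}\}$, where $T_{ij}\colon X_j\to X_i$ is bounded. Let $B^+(X)$ be the unital algebra of bounded operators whose matrices are lower triangular ($T_{ij}=0$ for $i<j$). For $A\in B^+(X)$ let $\sigma(A)$ be the spectrum of $A$ in $B(X)$ and $\sigma^+(A)\supseteq\sigma(A)$ the causal spectrum of $A$, i.e. its spectrum in the algebra $B^+(X)$. For $t\in\mathbb R$, $t\ne0$, and $\lambda\in\mathbb C$ put $$\exp_{+,t}(\lambda)=\begin{cases}e^{\lambda t},&t>0,\\0,&t<0,\end{cases}\qquad \exp_{-,t}(\lambda)=\begin{cases}0,&t>0,\\-e^{\lambda t},&t<0,\end{cases}\qquad g_t(\lambda)=\begin{cases}\exp_{-,t}(\lambda),&\operatorname{Re}\lambda>0,\\ \exp_{+,t}(\lambda),&\operatorname{Re}\lambda<0.\end{cases}$$ The domain $D$ of $\exp_{\pm,t}$ is $\mathbb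 C$ and the domain $D$ of $g_t$ is $\{\lambda:\operatorname{Re}\lambda\neq0\}$. A contour $\Gamma$ (a finite family of oriented closed piecewise $C^1$ curves) *surrounds $K$ in $D$* if it lies in $D\setminus K$, has winding number $1$ about every point of $K$, and has winding number $0$ about every point outside $D$. For $f\in\{\exp_{+,t},\exp_{-,t},g_t\}$ with domain $D$ put $$f(A)=\frac1{2\pi i}\int_{\Gamma}f(\lambda)(\lambda\mathbf 1-A)^{-1}\,d\lambda ,$$ where $\Gamma$ surrounds $\sigma(A)$ in $D$, and, for $i_1>i_2>\dots>i_m$, let the operator divided difference be $$f^{[m-1]}(A;i_1,\dots,i_m)=\frac1{2\pi i}\int_{\Gamma'}f(\lambda)(\lambda\mathbf1-A_{i_1i_1})^{-1}A_{i_1i_2}(\lambda\mathbf1-A_{i_2i_2})^{-1}A_{i_2i_3}\cdots A_{i_{m-1}i_m}(\lambda\mathbf1-A_{i_mi_m})^{-1}\,d\lambda ,$$ where $\Gamma'$ surrounds $\sigma^+(A)$ in $D$. **Theorem.** Let $A\in B^+(X)$ and $t\neq0$. (1) For $f=\exp_{+,t}$ and for $f=\exp_{-,t}$, contours $\Gamma$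 and $\Gamma'$ as above exist, and for every choice of them the matrix of $f(A)$ is lower triangular, $f(A)_{ij}=0$ for $i<j$, and for $i\ge j$ $$f(A)_{ij}=\sum_{i=i_1>i_2>\dots>i_m=j}f^{[m-1]}(A;i_1,i_2,\dots,i_m),$$ the sum being over all $m\ge1$ and all strictly decreasing chains of indices from $i$ to $j$. (2) If $\sigma(A)$ does not intersect the imaginary axis, the same holds for $f=g_t$. -/

import Mathlib

noncomputable section

namespace BlockTri

/-! ### Contours in the complex plane -/

/-- A closed piecewise continuously differentiable curve, parametrized by `[0, 1]`: a continuous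
curve that is `C¹` near every parameter outside a finite set, with integrable derivative. -/
structure ClosedCurve where
  toFun : ℝ → ℂ
  continuousOn : ContinuousOn toFun (Set.Icc 0 1)
  closed : toFun 0 = toFun 1
  piecewise : ∃ s : Finset ℝ, ∀ t ∈ Set.Icc (0 : ℝ) 1, t ∉ s → ContDiffAt ℝ 1 toFun t
  integrable : IntervalIntegrable (deriv toFun) MeasureTheory.volume 0 1

/-- A contour: finitely many oriented closed curves (repetitions are allowed). -/
abbrev Contour := List ClosedCurve

/-- The integral `∫_Γ F(λ) dλ` of a vector-valued function along a contour. -/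
def contourIntegral {E : Type*} [NormedAddCommGroup E] [NormedSpace ℂ E]
    (Γ : Contour) (F : ℂ → E) : E :=
  (Γ.map fun γ => ∫ t in (0 : ℝ)..1, deriv γ.toFun t • F (γ.toFun t)).sum

/-- The winding number `(2πi)⁻¹ ∫_Γ dλ / (λ - w)`. -/
def windingNumber (Γ : Contour) (w : ℂ) : ℂ :=
  (2 * (Real.pi : ℂ) * Complex.I)⁻¹ * contourIntegral Γ fun z => (z - w)⁻¹

/-- `Γ` lies in `D \ K`, surrounds `K` once in the counterclockwise direction, and everything
inside `Γ` belongs to `D` (so that a function analytic on `D` is analytic inside `Γ`). -/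
structure Surrounds (Γ : Contour) (D K : Set ℂ) : Prop where
  trace_subset : ∀ γ ∈ Γ, ∀ t ∈ Set.Icc (0 : ℝ) 1, γ.toFun t ∈ D \ K
  winding_eq_one : ∀ w ∈ K, windingNumber Γ w = 1
  winding_eq_zero : ∀ w ∉ D, windingNumber Γ w = 0

/-! ### The functions `exp_{±,t}` and `g_t` -/

/-- `exp_{+,t}` (used only for `t ≠ 0`). -/
def expPlus (t : ℝ) (z : ℂ) : ℂ := if 0 < t then Complex.exp (z * t) else 0

/-- `exp_{-,t}` (used only for `t ≠ 0`). -/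
def expMinus (t : ℝ) (z : ℂ) : ℂ := if t < 0 then -Complex.exp (z * t) else 0

/-- The domain of `g_t`: the complement of the imaginary axis. -/
def greenDomain : Set ℂ := {z | z.re ≠ 0}

/-- `g_t` (used only for `t ≠ 0` and on `greenDomain`). -/
def green (t : ℝ) (z : ℂ) : ℂ := if 0 < z.re then expMinus t z else expPlus t z

/-! ### Direct decompositions and operator matrices -/

/-- A representation of `X` as the direct sum `X₁ ⊕ ⋯ ⊕ Xₙ` of closed nonzero subspaces. -/
structure Decomposition (X : Type*) [NormedAddCommGroup X] [NormedSpace ℂ X] (n : ℕ) where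
  space : Fin n → Submodule ℂ X
  isClosed : ∀ i, IsClosed (space i : Set X)
  ne_bot : ∀ i, space i ≠ ⊥
  existsUnique : ∀ x : X, ∃! v : (i : Fin n) → space i, ∑ i, (v i : X) = x

variable {X : Type*} [NormedAddCommGroup X] [NormedSpace ℂ X] {n : ℕ}

namespace Decomposition

/-- The map `(x₁, …, xₙ) ↦ x₁ + ⋯ + xₙ`. -/
def sumMap (V : Decomposition X n) : ((i : Fin n) → V.space i) →L[ℂ] X :=
  ∑ i, (V.space i).subtypeL ∘L ContinuousLinearMap.proj i

theorem sumMap_apply (V : Decomposition X n) (v : (i : Fin n) → V.space i) :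
    V.sumMap v = ∑ i, (v i : X) := by
  simp [sumMap]

theorem sumMap_bijective (V : Decomposition X n) : Function.Bijective V.sumMap := by
  rw [Function.bijective_iff_existsUnique]
  intro x
  simpa only [sumMap_apply] using V.existsUnique x

variable [CompleteSpace X]

/-- The linear homeomorphism of `X₁ × ⋯ × Xₙ` onto `X`. -/
def sumEquiv (V : Decomposition X n) : ((i : Fin n) → V.space i) ≃L[ℂ] X :=
  haveI : ∀ i, CompleteSpace (V.space i) := fun i => (V.isClosed i).completeSpace_coe
  ContinuousLinearEquiv.ofBijective V.sumMap
    (LinearMap.ker_eq_bot.mpr V.sumMap_bijective.1)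
    (LinearMap.range_eq_top.mpr V.sumMap_bijective.2)

/-- The bounded operator `x ↦ xᵢ` taking the `i`-th component. -/
def component (V : Decomposition X n) (i : Fin n) : X →L[ℂ] V.space i :=
  ContinuousLinearMap.proj i ∘L (V.sumEquiv.symm : X →L[ℂ] ((i : Fin n) → V.space i))

/-- The entry `T_{ij} : X_j → X_i` of the operator matrix of `T`. -/
def block (V : Decomposition X n) (T : X →L[ℂ] X) (i j : Fin n) :
    V.space j →L[ℂ] V.space i :=
  V.component i ∘L T ∘L (V.space j).subtypeL

theorem sum_component (V : Decomposition X n) (x : X) :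
    ∑ i, (V.component i x : X) = x := by
  have h : V.sumMap (V.sumEquiv.symm x) = x := V.sumEquiv.apply_symm_apply x
  rw [sumMap_apply] at h
  exact h

theorem component_apply (V : Decomposition X n) (v : (i : Fin n) → V.space i) (i : Fin n) :
    V.component i (∑ k, (v k : X)) = v i := by
  have h : V.sumEquiv.symm (V.sumMap v) = v := V.sumEquiv.symm_apply_apply v
  rw [sumMap_apply] at h
  exact congrFun h i

theorem component_of_ne (V : Decomposition X n) {i j : Fin n} (h : i ≠ j) (x : V.space j) :
    V.component i (x : X) = 0 := by
  have hx : ∑ k, ((Pi.single j x : (k : Fin n) → V.space k) k : X) = x := by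
    rw [Finset.sum_eq_single j]
    · simp
    · intro k _ hk
      simp [Pi.single_eq_of_ne hk]
    · simp
  have := V.component_apply (Pi.single j x) i
  rw [hx] at this
  rw [this, Pi.single_eq_of_ne h]

theorem block_mul (V : Decomposition X n) (S T : X →L[ℂ] X) (i j : Fin n) :
    V.block (S * T) i j = ∑ k, V.block S i k ∘L V.block T k j := by
  ext x
  have h : T (x : X) = ∑ k, (V.component k (T (x : X)) : X) := (V.sum_component _).symm
  have h2 : V.block (S * T) i j x = V.component i (S (T (x : X))) := rfl
  rw [h2, h]
  simp [block]

/-- The algebra of causal operators: those whose matrix is lower triangular. -/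
def causal (V : Decomposition X n) : Subalgebra ℂ (X →L[ℂ] X) where
  carrier := {T | ∀ i j, i < j → V.block T i j = 0}
  mul_mem' := by
    intro S T hS hT i j hij
    rw [block_mul]
    refine Finset.sum_eq_zero fun k _ => ?_
    rcases lt_or_ge i k with h | h
    · rw [hS i k h, ContinuousLinearMap.zero_comp]
    · rw [hT k j (lt_of_le_of_lt h hij), ContinuousLinearMap.comp_zero]
  add_mem' := by
    intro S T hS hT i j hij
    have h : V.block (S + T) i j = V.block S i j + V.block T i j := by
      ext x
      simp [block]
    rw [h, hS i j hij, hT i j hij, add_zero]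
  algebraMap_mem' := by
    intro r i j hij
    ext x
    simp [block, Algebra.algebraMap_eq_smul_one, V.component_of_ne hij.ne x]

/-- The (ordinary) spectrum `σ(A)` of a causal operator, in the algebra of all bounded operators. -/
def ordinarySpectrum (V : Decomposition X n) (A : V.causal) : Set ℂ :=
  spectrum ℂ (A : X →L[ℂ] X)

/-- The causal spectrum `σ⁺(A)`: the spectrum of `A` in the algebra of causal operators. -/
def causalSpectrum (V : Decomposition X n) (A : V.causal) : Set ℂ :=
  spectrum ℂ A

end Decomposition

/-- Strictly decreasing chains of indices `i = i₁ > i₂ > ⋯ > i_m = j`, `m ≥ 1`. -/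
inductive Chain {n : ℕ} : Fin n → Fin n → Type
  | single (i : Fin n) : Chain i i
  | cons (i : Fin n) {k j : Fin n} (h : k < i) (c : Chain k j) : Chain i j

theorem Chain.finite {n : ℕ} (j : Fin n) : ∀ i : Fin n, Finite (Chain i j) := by
  intro i
  induction i using WellFoundedLT.induction with
  | ind i ih =>
    have : ∀ k : {k : Fin n // k < i}, Finite (Chain k.1 j) := fun k => ih k.1 k.2
    refine Finite.of_surjective
      (fun s : PLift (i = j) ⊕ (Σ k : {k : Fin n // k < i}, Chain k.1 j) =>
        (match s with
          | Sum.inl h => h.down ▸ Chain.single i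
          | Sum.inr p => Chain.cons i p.1.2 p.2 : Chain i j)) ?_
    intro c
    cases c with
    | single => exact ⟨Sum.inl ⟨rfl⟩, rfl⟩
    | cons _ h c => exact ⟨Sum.inr ⟨⟨_, h⟩, c⟩, rfl⟩

instance Chain.instFintype {n : ℕ} (i j : Fin n) : Fintype (Chain i j) :=
  have := Chain.finite j i
  Fintype.ofFinite _

namespace Decomposition

variable [CompleteSpace X]

/-- For the chain `i = i₁ > ⋯ > i_m = j`, the operator
`(λ - A_{i₁i₁})⁻¹ A_{i₁i₂} (λ - A_{i₂i₂})⁻¹ A_{i₂i₃} ⋯ A_{i_{m-1}i_m} (λ - A_{i_m i_m})⁻¹`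
from `X_j` to `X_i`. -/
def resolventProduct (V : Decomposition X n) (A : X →L[ℂ] X) (z : ℂ) :
    {i j : Fin n} → Chain i j → (V.space j →L[ℂ] V.space i)
  | _, _, .single i => resolvent (V.block A i i) z
  | _, _, .cons i (k := k) _ c =>
      resolvent (V.block A i i) z ∘L V.block A i k ∘L V.resolventProduct A z c

/-- The operator divided difference
`f^{[m-1]}(A; i₁, …, i_m) = (2πi)⁻¹ ∫_Γ f(λ) (λ - A_{i₁i₁})⁻¹ A_{i₁i₂} ⋯ (λ - A_{i_m i_m})⁻¹ dλ`,
computed along the contour `Γ`. -/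
def dividedDifference (V : Decomposition X n) (f : ℂ → ℂ) (Γ : Contour) (A : V.causal)
    {i j : Fin n} (c : Chain i j) : V.space j →L[ℂ] V.space i :=
  (2 * (Real.pi : ℂ) * Complex.I)⁻¹ •
    contourIntegral Γ fun z => f z • V.resolventProduct (A : X →L[ℂ] X) z c

end Decomposition

/-- `f(A) = (2πi)⁻¹ ∫_Γ f(λ) (λ - A)⁻¹ dλ`, computed along the contour `Γ`. -/
def functionOfOperator (f : ℂ → ℂ) (Γ : Contour) (A : X →L[ℂ] X) : X →L[ℂ] X :=
  (2 * (Real.pi : ℂ) * Complex.I)⁻¹ • contourIntegral Γ fun z => f z • resolvent A z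

end BlockTri

end

noncomputable section

namespace BlockTri

open MeasureTheory Set Filter Topology

/-! For `z` outside the causal spectrum the resolvent `S = (z - A)⁻¹` is itself lower triangular, so
`(z - A) S = 1` can be solved entry by entry: `S_ij = (z - A_ii)⁻¹ (δ_ij + ∑_{k<i} A_ik S_kj)`.
Iterating this recursion expands `S_ij` into the sum of resolvent products over decreasing chains
(`block_resolvent_eq_sum`). Multiplying by `f(z)` and integrating over `Γ'` gives the formula,
because taking a block is a bounded linear map. It remains to replace `Γ` by `Γ'`. The cycle `Γ -
Γ'` has winding number zero about every point outside `D \ σ(A)`, where `f(z)(z - A)⁻¹` is analytic,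
so the homology form of Cauchy's theorem applies (`contourIntegral_eq_zero`, by Dixon's argument
with Liouville's theorem). For `g_t` a contour around `σ⁺(A)` exists because `σ⁺(A)` also misses the
imaginary axis: it adds to `σ(A)` only points from bounded components of the complement, while the
axis is connected and unbounded. -/

variable {E E' : Type*} [NormedAddCommGroup E] [NormedSpace ℂ E]
  [NormedAddCommGroup E'] [NormedSpace ℂ E']

/-! ### Contour integrals: linearity, bounds, primitives, reversal. -/

/-- The set of points lying on a contour. -/
def trace (Γ : Contour) : Set ℂ := ⋃ γ ∈ Γ, γ.toFun '' Icc 0 1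

theorem mem_trace {Γ : Contour} {γ : ClosedCurve} (hγ : γ ∈ Γ) {t : ℝ} (ht : t ∈ Icc (0 : ℝ) 1) :
    γ.toFun t ∈ trace Γ :=
  mem_biUnion hγ (mem_image_of_mem _ ht)

theorem trace_subset_iff {Γ : Contour} {U : Set ℂ} :
    trace Γ ⊆ U ↔ ∀ γ ∈ Γ, ∀ t ∈ Icc (0 : ℝ) 1, γ.toFun t ∈ U := by
  simp only [trace, iUnion₂_subset_iff, image_subset_iff]
  rfl

theorem isCompact_trace (Γ : Contour) : IsCompact (trace Γ) := by
  have : trace Γ = ⋃ γ ∈ {γ | γ ∈ Γ}, γ.toFun '' Icc 0 1 := rfl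
  rw [this]
  exact (List.finite_toSet Γ).isCompact_biUnion fun γ _ => isCompact_Icc.image_of_continuousOn
    γ.continuousOn

theorem trace_append (Γ Γ' : Contour) : trace (Γ ++ Γ') = trace Γ ∪ trace Γ' := by
  ext z
  simp only [trace, List.mem_append, mem_iUnion, mem_union, exists_prop, or_and_right, exists_or]

theorem ClosedCurve.intervalIntegrable (γ : ClosedCurve) {F : ℂ → E}
    (hF : ContinuousOn F (γ.toFun '' Icc 0 1)) :
    IntervalIntegrable (fun t => deriv γ.toFun t • F (γ.toFun t)) volume 0 1 := by
  refine γ.integrable.smul_continuousOn ?_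
  rw [uIcc_of_le zero_le_one]
  exact hF.comp γ.continuousOn (mapsTo_image _ _)

theorem continuousOn_curve {E : Type*} [NormedAddCommGroup E] {Γ : Contour} {γ : ClosedCurve}
    (hγ : γ ∈ Γ) {F : ℂ → E}
    (hF : ContinuousOn F (trace Γ)) : ContinuousOn F (γ.toFun '' Icc 0 1) :=
  hF.mono (subset_biUnion_of_mem (u := fun γ : ClosedCurve => γ.toFun '' Icc (0 : ℝ) 1) hγ)

theorem contourIntegral_append (Γ Γ' : Contour) (F : ℂ → E) :
    contourIntegral (Γ ++ Γ') F = contourIntegral Γ F + contourIntegral Γ' F := by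
  simp [contourIntegral]

theorem contourIntegral_congr {Γ : Contour} {F G : ℂ → E} (h : EqOn F G (trace Γ)) :
    contourIntegral Γ F = contourIntegral Γ G := by
  unfold contourIntegral
  congr 1
  refine List.map_congr_left fun γ hγ => ?_
  refine intervalIntegral.integral_congr fun t ht => ?_
  rw [uIcc_of_le zero_le_one] at ht
  rw [h (mem_trace hγ ht)]

theorem contourIntegral_add {Γ : Contour} {F G : ℂ → E} (hF : ContinuousOn F (trace Γ))
    (hG : ContinuousOn G (trace Γ)) :
    contourIntegral Γ (fun z => F z + G z) = contourIntegral Γ F + contourIntegral Γ G := by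
  unfold contourIntegral
  rw [← List.sum_map_add]
  congr 1
  refine List.map_congr_left fun γ hγ => ?_
  rw [← intervalIntegral.integral_add (γ.intervalIntegrable (continuousOn_curve hγ hF))
    (γ.intervalIntegrable (continuousOn_curve hγ hG))]
  simp only [smul_add]

theorem contourIntegral_clm [CompleteSpace E] [CompleteSpace E'] {Γ : Contour} (L : E →L[ℂ] E')
    {F : ℂ → E} (hF : ContinuousOn F (trace Γ)) :
    contourIntegral Γ (fun z => L (F z)) = L (contourIntegral Γ F) := by
  unfold contourIntegral
  rw [map_list_sum, List.map_map]
  congr 1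
  refine List.map_congr_left fun γ hγ => ?_
  simp only [Function.comp_apply]
  rw [← L.intervalIntegral_comp_comm (γ.intervalIntegrable (continuousOn_curve hγ hF))]
  simp only [map_smul]

theorem contourIntegral_zero (Γ : Contour) : contourIntegral Γ (fun _ => (0 : E)) = 0 := by
  simp [contourIntegral]

theorem contourIntegral_sub [CompleteSpace E] {Γ : Contour} {F G : ℂ → E}
    (hF : ContinuousOn F (trace Γ)) (hG : ContinuousOn G (trace Γ)) :
    contourIntegral Γ (fun z => F z - G z) = contourIntegral Γ F - contourIntegral Γ G := by
  have h := contourIntegral_clm (-ContinuousLinearMap.id ℂ E) hG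
  simp only [neg_apply, ContinuousLinearMap.id_apply] at h
  simp only [sub_eq_add_neg]
  rw [← h]
  exact contourIntegral_add hF hG.neg

theorem contourIntegral_sum {ι : Type*} (s : Finset ι) {Γ : Contour} {F : ι → ℂ → E}
    (hF : ∀ i ∈ s, ContinuousOn (F i) (trace Γ)) :
    contourIntegral Γ (fun z => ∑ i ∈ s, F i z) = ∑ i ∈ s, contourIntegral Γ (F i) := by
  classical
  induction s using Finset.induction_on with
  | empty => simp [contourIntegral_zero]
  | insert a s ha ih =>
    simp only [Finset.sum_insert ha]
    rw [contourIntegral_add (hF a (Finset.mem_insert_self _ _))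
      (continuousOn_finsetSum s fun i hi => hF i (Finset.mem_insert_of_mem hi)),
      ih fun i hi => hF i (Finset.mem_insert_of_mem hi)]

/-- `L` is the total length of the contour. It is chosen before `F`, so one constant serves a whole
family of integrands. -/
theorem exists_norm_contourIntegral_le (Γ : Contour) :
    ∃ L : ℝ, 0 ≤ L ∧ ∀ (F : ℂ → E) (C : ℝ), (∀ z ∈ trace Γ, ‖F z‖ ≤ C) →
      ‖contourIntegral Γ F‖ ≤ L * C := by
  induction Γ with
  | nil => exact ⟨0, le_rfl, fun F C _ => by simp [contourIntegral]⟩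
  | cons γ Γ ih =>
    obtain ⟨L, hL, h⟩ := ih
    refine ⟨(∫ t in (0 : ℝ)..1, ‖deriv γ.toFun t‖) + L, ?_, fun F C hC => ?_⟩
    · have := intervalIntegral.integral_nonneg (f := fun t => ‖deriv γ.toFun t‖)
        (μ := volume) (zero_le_one (α := ℝ)) fun _ _ => norm_nonneg _
      positivity
    · have h1 : contourIntegral (γ :: Γ) F =
          (∫ t in (0 : ℝ)..1, deriv γ.toFun t • F (γ.toFun t)) + contourIntegral Γ F := by
        simp [contourIntegral]
      have hsub : trace Γ ⊆ trace (γ :: Γ) := by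
        simp only [trace]
        exact biUnion_subset_biUnion_left fun δ hδ => List.mem_cons_of_mem _ hδ
      rw [h1, add_mul]
      refine (norm_add_le _ _).trans (add_le_add ?_ (h F C fun z hz => hC z (hsub hz)))
      rw [← intervalIntegral.integral_mul_const]
      refine intervalIntegral.norm_integral_le_of_norm_le zero_le_one ?_
        (γ.integrable.norm.mul_const C)
      refine Eventually.of_forall fun t ht => ?_
      rw [norm_smul]
      exact mul_le_mul_of_nonneg_left
        (hC _ (mem_trace List.mem_cons_self (Ioc_subset_Icc_self ht))) (norm_nonneg _)

/-- The fundamental theorem of calculus on each curve gives `Φ(end) - Φ(start)`, which vanishes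
because the curve is closed; the finitely many corners form a countable exceptional set. -/
theorem contourIntegral_eq_zero_of_hasDerivAt [CompleteSpace E] {Γ : Contour} {Φ φ : ℂ → E}
    (hΦ : ∀ z ∈ trace Γ, HasDerivAt Φ (φ z) z) (hφ : ContinuousOn φ (trace Γ)) :
    contourIntegral Γ φ = 0 := by
  unfold contourIntegral
  refine List.sum_eq_zero ?_
  simp only [List.mem_map]
  rintro _ ⟨γ, hγ, rfl⟩
  obtain ⟨s, hs⟩ := γ.piecewise
  have hc : ContinuousOn (Φ ∘ γ.toFun) (uIcc 0 1) := by
    rw [uIcc_of_le zero_le_one]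
    intro t ht
    exact (hΦ _ (mem_trace hγ ht)).continuousAt.comp_continuousWithinAt (γ.continuousOn t ht)
  have h := MeasureTheory.integral_eq_of_hasDerivAt_off_countable (Φ ∘ γ.toFun)
    (fun t => deriv γ.toFun t • φ (γ.toFun t)) s.finite_toSet.countable hc ?_
    (γ.intervalIntegrable (continuousOn_curve hγ hφ))
  · rw [h]
    simp [γ.closed]
  · rintro t ⟨ht, hts⟩
    simp only [zero_le_one, min_eq_left, max_eq_right] at ht
    have ht' := Ioo_subset_Icc_self ht
    exact (hΦ _ (mem_trace hγ ht')).scomp t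
      ((hs t ht' hts).differentiableAt one_ne_zero).hasDerivAt

/-- The curve run through in the opposite direction. -/
def ClosedCurve.reverse (γ : ClosedCurve) : ClosedCurve where
  toFun t := γ.toFun (1 - t)
  continuousOn := γ.continuousOn.comp (by fun_prop) fun t ht =>
    ⟨by linarith [ht.2], by linarith [ht.1]⟩
  closed := by simp [γ.closed]
  piecewise := by
    classical
    obtain ⟨s, hs⟩ := γ.piecewise
    refine ⟨s.image fun t => 1 - t, fun t ht hts => ?_⟩
    have h1 : ContDiffAt ℝ 1 γ.toFun (1 - t) := by
      refine hs _ ⟨by linarith [ht.2], by linarith [ht.1]⟩ fun h => hts ?_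
      exact Finset.mem_image.mpr ⟨1 - t, h, by ring⟩
    exact ContDiffAt.comp t h1 (by fun_prop)
  integrable := by
    have h := (γ.integrable.comp_sub_left 1).neg.symm
    simp only [sub_zero, sub_self] at h
    refine h.congr fun t _ => ?_
    rw [deriv_comp_const_sub]
    rfl

/-- The contour with all curves run through in the opposite direction. -/
def reverse (Γ : Contour) : Contour := Γ.map ClosedCurve.reverse

theorem trace_reverse_subset (Γ : Contour) : trace (reverse Γ) ⊆ trace Γ := by
  rw [trace_subset_iff]
  intro γ hγ t ht
  obtain ⟨δ, hδ, rfl⟩ := List.mem_map.mp hγ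
  exact mem_trace hδ ⟨by linarith [ht.2], by linarith [ht.1]⟩

theorem contourIntegral_reverse (Γ : Contour) (F : ℂ → E) :
    contourIntegral (reverse Γ) F = -contourIntegral Γ F := by
  unfold contourIntegral reverse
  rw [List.map_map, List.sum_neg, List.map_map]
  congr 1
  refine List.map_congr_left fun γ _ => ?_
  have h := intervalIntegral.integral_comp_sub_left (a := 0) (b := 1)
    (fun t => deriv γ.toFun t • F (γ.toFun t)) 1
  simp only [sub_zero, sub_self] at h
  simp only [Function.comp_apply, ClosedCurve.reverse, deriv_comp_const_sub, neg_smul]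
  rw [intervalIntegral.integral_neg, h]

/-! ### Winding numbers. -/

theorem windingNumber_append (Γ Γ' : Contour) (w : ℂ) :
    windingNumber (Γ ++ Γ') w = windingNumber Γ w + windingNumber Γ' w := by
  simp [windingNumber, contourIntegral_append, mul_add]

theorem windingNumber_reverse (Γ : Contour) (w : ℂ) :
    windingNumber (reverse Γ) w = -windingNumber Γ w := by
  simp [windingNumber, contourIntegral_reverse]

theorem continuousOn_inv_sub {s : Set ℂ} {z : ℂ} (hz : z ∉ s) :
    ContinuousOn (fun w => (w - z)⁻¹) s :=
  ContinuousOn.inv₀ (by fun_prop) fun w hw => sub_ne_zero.mpr fun h => hz (h ▸ hw)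

/-- The difference of the two Cauchy kernels has the primitive `log ((w - z') / (w - z))`: the
quotient is `1 + (z - z') / (w - z)`, within distance less than `1` of `1`, so the principal branch
suffices and integrality of winding numbers is not needed. -/
theorem windingNumber_eq_of_near {Γ : Contour} {z z' : ℂ}
    (h : ∀ w ∈ trace Γ, ‖z - z'‖ < ‖w - z‖) : windingNumber Γ z' = windingNumber Γ z := by
  have hz : z ∉ trace Γ := fun hz => by
    have := h z hz
    simp only [sub_self, norm_zero] at this
    exact absurd this (norm_nonneg _).not_gt
  have hz' : z' ∉ trace Γ := fun hz' => by
    have := h z' hz'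
    rw [norm_sub_rev] at this
    exact lt_irrefl _ this
  have key := contourIntegral_eq_zero_of_hasDerivAt (Γ := Γ)
    (Φ := fun w => Complex.log ((w - z') / (w - z)))
    (φ := fun w => (w - z')⁻¹ - (w - z)⁻¹) (fun w hw => ?_)
    ((continuousOn_inv_sub hz').sub (continuousOn_inv_sub hz))
  · rw [contourIntegral_sub (continuousOn_inv_sub hz') (continuousOn_inv_sub hz)] at key
    rw [windingNumber, windingNumber, sub_eq_zero.mp key]
  · have h1 : w - z ≠ 0 := sub_ne_zero.mpr fun h => hz (h ▸ hw)
    have h2 : w - z' ≠ 0 := sub_ne_zero.mpr fun h => hz' (h ▸ hw)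
    have hs : (w - z') / (w - z) ∈ Complex.slitPlane := by
      have : (w - z') / (w - z) = 1 + (z - z') / (w - z) := by
        field_simp
        ring
      rw [this]
      refine Complex.mem_slitPlane_of_norm_lt_one ?_
      rw [norm_div, div_lt_one (norm_pos_iff.mpr h1)]
      exact h w hw
    have hd := (((hasDerivAt_id w).sub_const z').fun_div ((hasDerivAt_id w).sub_const z) h1).clog hs
    refine hd.congr_deriv ?_
    simp only [id]
    field_simp

/-- Here `log (1 - w / z)` is a primitive of the kernel, since `|w / z| < 1` on the contour. -/
theorem windingNumber_eq_zero_of_far {Γ : Contour} {z : ℂ}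
    (h : ∀ w ∈ trace Γ, ‖w‖ < ‖z‖) : windingNumber Γ z = 0 := by
  have hz : z ∉ trace Γ := fun hz => lt_irrefl _ (h z hz)
  have key := contourIntegral_eq_zero_of_hasDerivAt (Γ := Γ)
    (Φ := fun w => Complex.log (1 - w / z)) (φ := fun w => (w - z)⁻¹) (fun w hw => ?_)
    (continuousOn_inv_sub hz)
  · rw [windingNumber, key, mul_zero]
  · have h1 : w - z ≠ 0 := sub_ne_zero.mpr fun h => hz (h ▸ hw)
    have h0 : z ≠ 0 := norm_pos_iff.mp ((norm_nonneg w).trans_lt (h w hw))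
    have hs : 1 - w / z ∈ Complex.slitPlane := by
      rw [sub_eq_add_neg]
      refine Complex.mem_slitPlane_of_norm_lt_one ?_
      rw [norm_neg, norm_div, div_lt_one (norm_pos_iff.mpr h0)]
      exact h w hw
    have hd := (((hasDerivAt_id w).div_const z).const_sub 1).clog hs
    refine hd.congr_deriv ?_
    have h2 : z - w ≠ 0 := fun h => h1 (by linear_combination -h)
    have h3 : 1 - w / z ≠ 0 := by
      intro h
      field_simp at h
      exact h2 (by simpa using h)
    simp only [id]
    field_simp
    ring

/-! ### Integrals with a parameter and Cauchy's theorem. -/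

/-- An integral along a contour depends holomorphically on a parameter. -/
theorem differentiableOn_contourIntegral [CompleteSpace E] {Γ : Contour} {V : Set ℂ}
    {G : ℂ → ℂ → E} (hd : ∀ w ∈ trace Γ, DifferentiableOn ℂ (fun z => G z w) V)
    (hc : ∀ z ∈ V, ContinuousOn (G z) (trace Γ))
    (hb : ∀ z₀ ∈ V, ∃ r > 0, ∃ C : ℝ, Metric.ball z₀ r ⊆ V ∧
      ∀ z ∈ Metric.ball z₀ r, ∀ w ∈ trace Γ, ‖G z w‖ ≤ C) :
    DifferentiableOn ℂ (fun z => contourIntegral Γ (G z)) V := by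
  have single : ∀ γ ∈ Γ, DifferentiableOn ℂ
      (fun z => ∫ t in (0 : ℝ)..1, deriv γ.toFun t • G z (γ.toFun t)) V := by
    intro γ hγ z₀ hz₀
    obtain ⟨r, hr, C, hrV, hC⟩ := hb z₀ hz₀
    have hr2 : 0 < r / 2 := by positivity
    have hint : ∀ z ∈ V, IntervalIntegrable (fun t => deriv γ.toFun t • G z (γ.toFun t))
        volume 0 1 := fun z hz => γ.intervalIntegrable (continuousOn_curve hγ (hc z hz))
    have hder : ∀ w ∈ trace Γ, ∀ z ∈ Metric.ball z₀ r,
        HasDerivAt (fun z => G z w) (deriv (fun z => G z w) z) z := fun w hw z hz =>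
      (((hd w hw).mono hrV).differentiableAt (Metric.isOpen_ball.mem_nhds hz)).hasDerivAt
    have hmem : ∀ t ∈ uIoc (0 : ℝ) 1, γ.toFun t ∈ trace Γ := fun t ht => by
      rw [uIoc_of_le zero_le_one] at ht
      exact mem_trace hγ (Ioc_subset_Icc_self ht)
    refine (intervalIntegral.hasDerivAt_integral_of_dominated_loc_of_deriv_le
      (s := Metric.ball z₀ (r / 2)) (bound := fun t => ‖deriv γ.toFun t‖ * (C / (r / 4)))
      (F' := fun z t => deriv γ.toFun t • deriv (fun z => G z (γ.toFun t)) z)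
      (Metric.ball_mem_nhds _ hr2) ?_ (hint z₀ hz₀) ?_ ?_
      (γ.integrable.norm.mul_const _) ?_).2.differentiableAt.differentiableWithinAt
    · filter_upwards [Metric.ball_mem_nhds z₀ hr] with z hz
      exact (intervalIntegrable_iff.mp (hint z (hrV hz))).aestronglyMeasurable
    -- The `z`-derivative of the integrand is measurable in `t` as a pointwise limit of difference
    -- quotients with steps `(r/2)/(k+1)`, which keep the points inside the ball of radius `r`.
    · have hu : Tendsto (fun k : ℕ => (((r / 2) / ((k : ℝ) + 1) : ℝ) : ℂ)) atTop (𝓝 0) := by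
        have h1 : Tendsto (fun k : ℕ => (r / 2) / ((k : ℝ) + 1)) atTop (𝓝 0) := by
          have := tendsto_one_div_add_atTop_nhds_zero_nat (𝕜 := ℝ) |>.const_mul (r / 2)
          simpa [div_eq_mul_inv] using this
        exact_mod_cast (Complex.continuous_ofReal.tendsto 0).comp h1
      have hune : ∀ k : ℕ, (((r / 2) / ((k : ℝ) + 1) : ℝ) : ℂ) ≠ 0 := fun k => by
        rw [Ne, Complex.ofReal_eq_zero]
        positivity
      have huV : ∀ k : ℕ, z₀ + (((r / 2) / ((k : ℝ) + 1) : ℝ) : ℂ) ∈ V := fun k => by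
        refine hrV ?_
        rw [Metric.mem_ball, dist_eq_norm, add_sub_cancel_left, Complex.norm_real,
          Real.norm_of_nonneg (by positivity)]
        have : r / 2 / ((k : ℝ) + 1) ≤ r / 2 :=
          div_le_self hr2.le (by linarith [(Nat.cast_nonneg k : (0 : ℝ) ≤ k)])
        linarith
      refine aestronglyMeasurable_of_tendsto_ae atTop
        (f := fun (k : ℕ) t => (((r / 2) / ((k : ℝ) + 1) : ℝ) : ℂ)⁻¹ •
          (deriv γ.toFun t • G (z₀ + (((r / 2) / ((k : ℝ) + 1) : ℝ) : ℂ)) (γ.toFun t) -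
            deriv γ.toFun t • G z₀ (γ.toFun t))) (fun k => ?_) ?_
      · exact (((intervalIntegrable_iff.mp (hint _ (huV k))).aestronglyMeasurable).sub
          (intervalIntegrable_iff.mp (hint _ hz₀)).aestronglyMeasurable).const_smul _
      · refine (ae_restrict_iff' measurableSet_uIoc).mpr (Eventually.of_forall fun t ht => ?_)
        have h1 := (hder _ (hmem t ht) z₀ (Metric.mem_ball_self hr)).const_smul
          (deriv γ.toFun t)
        have h2 := h1.tendsto_slope_zero.comp
          (tendsto_nhdsWithin_iff.mpr ⟨hu, Eventually.of_forall hune⟩)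
        exact h2
    · refine Eventually.of_forall fun t ht z hz => ?_
      rw [norm_smul]
      refine mul_le_mul_of_nonneg_left ?_ (norm_nonneg _)
      -- Cauchy's estimate on a circle of radius `r/4` about `z`, which stays in the larger ball
      -- because `r/2 + r/4 < r`, gives the dominating factor `C / (r/4)`.
      have hsub : Metric.closedBall z (r / 4) ⊆ Metric.ball z₀ r := by
        refine Metric.closedBall_subset_ball' ?_
        rw [Metric.mem_ball] at hz
        linarith
      refine Complex.norm_deriv_le_of_forall_mem_sphere_norm_le (by positivity) ?_ ?_
      · refine DifferentiableOn.diffContOnCl ?_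
        rw [closure_ball z (by positivity)]
        exact (hd _ (hmem t ht)).mono (hsub.trans hrV)
      · exact fun x hx => hC x (hsub (Metric.sphere_subset_closedBall hx)) _ (hmem t ht)
    · refine Eventually.of_forall fun t ht z hz => ?_
      exact (hder _ (hmem t ht) z (Metric.ball_subset_ball (by linarith) hz)).const_smul _
  unfold contourIntegral
  clear hd hc hb
  induction Γ with
  | nil => simp
  | cons γ Γ ih =>
    simp only [List.map_cons, List.sum_cons]
    exact (single γ List.mem_cons_self).add
      (ih fun δ hδ => single δ (List.mem_cons_of_mem _ hδ))

/-- Supplies the local bound for differentiating under the integral in Dixon's argument. For `w` in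
a closed disc about `z₀` the mean value inequality bounds the slope by the derivative; for `w`
outside it, `‖w - z‖ ≥ R/2` and `F` is bounded. -/
theorem exists_norm_dslope_le [CompleteSpace E] {U K : Set ℂ} (hU : IsOpen U) (hK : IsCompact K)
    (hKU : K ⊆ U) {F : ℂ → E} (hF : DifferentiableOn ℂ F U) {z₀ : ℂ} (hz₀ : z₀ ∈ U) :
    ∃ r > 0, ∃ C : ℝ, Metric.ball z₀ r ⊆ U ∧
      ∀ z ∈ Metric.ball z₀ r, ∀ w ∈ K, ‖dslope F z w‖ ≤ C := by
  obtain ⟨R, hR, hRU⟩ := Metric.nhds_basis_closedBall.mem_iff.mp (hU.mem_nhds hz₀)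
  have hR2 : Metric.ball z₀ (R / 2) ⊆ Metric.closedBall z₀ R :=
    Metric.ball_subset_closedBall.trans (Metric.closedBall_subset_closedBall (by linarith))
  obtain ⟨C, hC⟩ := (isCompact_closedBall z₀ R).exists_bound_of_continuousOn
    ((hF.deriv hU).continuousOn.mono hRU)
  obtain ⟨M, hM⟩ := ((isCompact_closedBall z₀ R).union hK).exists_bound_of_continuousOn
    (hF.continuousOn.mono (union_subset hRU hKU))
  refine ⟨R / 2, by positivity, max C ((M + M) / (R / 2)), hR2.trans hRU, fun z hz w hw => ?_⟩
  by_cases hwz : w = z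
  · subst hwz
    rw [dslope_same]
    exact (hC _ (hR2 hz)).trans (le_max_left _ _)
  have hpos : 0 < ‖w - z‖ := norm_pos_iff.mpr (sub_ne_zero.mpr hwz)
  rw [dslope_of_ne _ hwz, slope_def_module, norm_smul, norm_inv, inv_mul_le_iff₀ hpos]
  by_cases hwR : w ∈ Metric.closedBall z₀ R
  · have := (convex_closedBall z₀ R).norm_image_sub_le_of_norm_deriv_le
      (fun x hx => hF.differentiableAt (hU.mem_nhds (hRU hx))) hC (hR2 hz) hwR
    refine this.trans ?_
    rw [mul_comm]
    exact mul_le_mul_of_nonneg_left (le_max_left _ _) hpos.le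
  · have h1 : R / 2 ≤ ‖w - z‖ := by
      rw [Metric.mem_closedBall, not_le] at hwR
      rw [Metric.mem_ball] at hz
      have := dist_triangle w z z₀
      rw [dist_eq_norm w z] at this
      linarith
    have h2 : ‖F w - F z‖ ≤ M + M :=
      (norm_sub_le _ _).trans (add_le_add (hM _ (Or.inr hw)) (hM _ (Or.inl (hR2 hz))))
    have h3 : (M + M) / (R / 2) ≤ max C ((M + M) / (R / 2)) := le_max_right _ _
    have h0 : 0 ≤ (M + M) / (R / 2) := by
      have := (norm_nonneg _).trans h2
      positivity
    calc ‖F w - F z‖ ≤ M + M := h2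
      _ = (R / 2) * ((M + M) / (R / 2)) := by field_simp
      _ ≤ ‖w - z‖ * ((M + M) / (R / 2)) := mul_le_mul_of_nonneg_right h1 h0
      _ ≤ _ := mul_le_mul_of_nonneg_left h3 hpos.le

/-- The homology form of Cauchy's theorem. -/
theorem contourIntegral_eq_zero [CompleteSpace E] {Γ : Contour} {U : Set ℂ} (hU : IsOpen U)
    (hΓU : trace Γ ⊆ U) (hw : ∀ w ∉ U, windingNumber Γ w = 0) {F : ℂ → E}
    (hF : DifferentiableOn ℂ F U) : contourIntegral Γ F = 0 := by
  obtain hΓ | ⟨z₀, hz₀⟩ := (trace Γ).eq_empty_or_nonempty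
  · rw [contourIntegral_congr (G := fun _ => 0) (by simp [hΓ]), contourIntegral_zero]
  -- Since `G` vanishes at `z₀`, its slope from `z₀` is `F`. The integral in question is therefore
  -- the value at `z₀` of Dixon's function `h`, which will be shown to vanish identically.
  set G : ℂ → E := fun w => (w - z₀) • F w with hGdef
  have hG : DifferentiableOn ℂ G U :=
    DifferentiableOn.smul (by fun_prop) hF
  have hGc : ContinuousOn G (trace Γ) := hG.continuousOn.mono hΓU
  set h : ℂ → E := fun z => contourIntegral Γ (dslope G z)
  have hcauchy : ∀ z ∉ trace Γ, ContinuousOn (fun w => (w - z)⁻¹ • G w) (trace Γ) :=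
    fun z hz => (continuousOn_inv_sub hz).smul hGc
  -- Where the winding number is zero the term with `G z` integrates to zero, leaving a Cauchy
  -- integral that makes sense even for `z` outside `U`.
  have hformula : ∀ z ∉ trace Γ, windingNumber Γ z = 0 →
      h z = contourIntegral Γ fun w => (w - z)⁻¹ • G w := by
    intro z hz hwz
    have h1 : h z = contourIntegral Γ fun w => (w - z)⁻¹ • G w - (w - z)⁻¹ • G z := by
      refine contourIntegral_congr fun w hw => ?_
      rw [dslope_of_ne _ (fun hwz : w = z => hz (hwz ▸ hw)), slope_def_module, smul_sub]
    have h2 : contourIntegral Γ (fun w => (w - z)⁻¹) = 0 := by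
      rw [windingNumber, mul_eq_zero] at hwz
      refine hwz.resolve_left (inv_ne_zero ?_)
      exact Complex.two_pi_I_ne_zero
    have h3 := contourIntegral_clm ((ContinuousLinearMap.id ℂ ℂ).smulRight (G z))
      (continuousOn_inv_sub hz)
    simp only [h2, map_zero, ContinuousLinearMap.smulRight_apply,
      ContinuousLinearMap.id_apply] at h3
    rw [h1, contourIntegral_sub (hcauchy z hz) (G := fun w => (w - z)⁻¹ • G z)
      ((continuousOn_inv_sub hz).smul continuousOn_const), h3, sub_zero]
  have hdU : DifferentiableOn ℂ h U := by
    refine differentiableOn_contourIntegral (fun w hw => ?_) (fun z hz => ?_) fun z hz =>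
      exists_norm_dslope_le hU (isCompact_trace Γ) hΓU hG hz
    -- The slope is symmetric in its two arguments, so holomorphy in the second gives holomorphy in
    -- the first.
    · refine ((Complex.differentiableOn_dslope (hU.mem_nhds (hΓU hw))).mpr hG).congr
        fun z _ => ?_
      by_cases hzw : z = w
      · rw [hzw]
      · rw [dslope_of_ne _ hzw, dslope_of_ne _ (Ne.symm hzw), slope_comm]
    · exact ((continuousOn_dslope (hU.mem_nhds hz)).mpr
        ⟨hG.continuousOn, hG.differentiableAt (hU.mem_nhds hz)⟩).mono hΓU
  have hdist : ∀ z ∉ trace Γ, ∃ δ > 0, ∀ z' ∈ Metric.ball z δ, ∀ w ∈ trace Γ,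
      δ ≤ ‖w - z'‖ ∧ ‖z - z'‖ < ‖w - z‖ := by
    intro z hz
    obtain ⟨δ, hδ, hδz⟩ := Metric.isOpen_iff.mp (isCompact_trace Γ).isClosed.isOpen_compl z hz
    refine ⟨δ / 2, by positivity, fun z' hz' w hw => ?_⟩
    have h1 : δ ≤ ‖w - z‖ := by
      by_contra! hlt
      exact hδz (by rwa [Metric.mem_ball, dist_eq_norm]) hw
    have h2 : ‖z' - z‖ < δ / 2 := by rwa [Metric.mem_ball, dist_eq_norm] at hz'
    have h3 : ‖w - z‖ ≤ ‖w - z'‖ + ‖z' - z‖ := norm_sub_le_norm_sub_add_norm_sub _ _ _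
    rw [norm_sub_rev z z']
    constructor <;> linarith
  obtain ⟨M, hM⟩ := (isCompact_trace Γ).exists_bound_of_continuousOn hGc
  have hM0 : 0 ≤ M := (norm_nonneg _).trans (hM z₀ hz₀)
  have hkernel : DifferentiableOn ℂ
      (fun z => contourIntegral Γ fun w => (w - z)⁻¹ • G w) (trace Γ)ᶜ := by
    refine differentiableOn_contourIntegral (fun w hw => ?_) hcauchy fun z hz => ?_
    · refine DifferentiableOn.smul_const (DifferentiableOn.inv (by fun_prop) fun z hz => ?_) _
      exact sub_ne_zero.mpr fun hwz => hz (hwz ▸ hw)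
    · obtain ⟨δ, hδ, hδ'⟩ := hdist z hz
      refine ⟨δ, hδ, δ⁻¹ * M, fun z' hz' hmem => ?_, fun z' hz' w hw => ?_⟩
      · have := (hδ' z' hz' z' hmem).1
        rw [sub_self, norm_zero] at this
        linarith
      · rw [norm_smul, norm_inv]
        have := (hδ' z' hz' w hw).1
        gcongr
        exact hM w hw
  -- At a point outside `U` the winding number vanishes, hence also nearby, and there `h` coincides
  -- with the holomorphic Cauchy integral.
  have hentire : Differentiable ℂ h := by
    intro z
    by_cases hz : z ∈ U
    · exact hdU.differentiableAt (hU.mem_nhds hz)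
    · have hzt : z ∉ trace Γ := fun hzt => hz (hΓU hzt)
      have hop : (trace Γ)ᶜ ∈ 𝓝 z := (isCompact_trace Γ).isClosed.isOpen_compl.mem_nhds hzt
      refine (hkernel.differentiableAt hop).congr_of_eventuallyEq ?_
      obtain ⟨δ, hδ, hδ'⟩ := hdist z hzt
      filter_upwards [Metric.ball_mem_nhds z hδ, hop] with z' hz' hz't
      refine hformula z' hz't ?_
      rw [windingNumber_eq_of_near fun w hw => (hδ' z' hz' w hw).2, hw z hz]
  obtain ⟨R, hR⟩ := (isCompact_trace Γ).isBounded.exists_norm_le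
  obtain ⟨L, hL, hLb⟩ := exists_norm_contourIntegral_le (E := E) Γ
  have hlim : Tendsto h (cocompact ℂ) (𝓝 0) := by
    have hb : Tendsto (fun z : ℂ => L * ((‖z‖ - R)⁻¹ * M)) (cocompact ℂ) (𝓝 0) := by
      have h1 : Tendsto (fun z : ℂ => ‖z‖ - R) (cocompact ℂ) atTop :=
        tendsto_atTop_add_const_right _ (-R) tendsto_norm_cocompact_atTop
      simpa using ((tendsto_inv_atTop_zero.comp h1).mul_const M).const_mul L
    refine squeeze_zero_norm' ?_ hb
    filter_upwards [tendsto_norm_cocompact_atTop.eventually_gt_atTop R] with z hz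
    have hzt : z ∉ trace Γ := fun hzt => hz.not_ge (hR z hzt)
    rw [hformula z hzt (windingNumber_eq_zero_of_far fun w hw => (hR w hw).trans_lt hz)]
    refine hLb _ _ fun w hw => ?_
    rw [norm_smul, norm_inv]
    have h1 : ‖z‖ - R ≤ ‖w - z‖ := by
      have := norm_sub_norm_le z w
      rw [norm_sub_rev] at this
      linarith [hR w hw]
    have h2 : 0 < ‖z‖ - R := sub_pos.mpr hz
    gcongr
    exact hM w hw
  have hz₀U : U ∈ 𝓝 z₀ := hU.mem_nhds (hΓU hz₀)
  -- Liouville: an entire function tending to zero at infinity is zero.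
  rw [← hentire.apply_eq_of_tendsto_cocompact z₀ hlim]
  refine contourIntegral_congr fun w _ => ?_
  by_cases hwz : w = z₀
  · subst hwz
    have hFd := (hF.differentiableAt hz₀U).hasDerivAt
    have := (((hasDerivAt_id w).sub_const w).fun_smul hFd).deriv
    rw [dslope_same]
    simpa [hGdef] using this.symm
  · rw [dslope_of_ne _ hwz, slope_def_module]
    simp [hGdef, smul_smul, inv_mul_cancel₀ (sub_ne_zero.mpr hwz)]

/-! ### Independence of the contour. -/

theorem Surrounds.trace_subset' {Γ : Contour} {D K : Set ℂ} (h : Surrounds Γ D K) :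
    trace Γ ⊆ D \ K :=
  trace_subset_iff.mpr h.trace_subset

/-- The integral of a function analytic on `D \ K` is the same for any contour surrounding `K`
and any contour surrounding a larger set. -/
theorem Surrounds.contourIntegral_eq [CompleteSpace E] {Γ Γ' : Contour} {D K K' : Set ℂ}
    (hD : IsOpen D) (hK : IsClosed K) (hKK' : K ⊆ K') (hΓ : Surrounds Γ D K)
    (hΓ' : Surrounds Γ' D K') {F : ℂ → E} (hF : DifferentiableOn ℂ F (D \ K)) :
    contourIntegral Γ F = contourIntegral Γ' F := by
  have h := contourIntegral_eq_zero (Γ := Γ ++ reverse Γ') (hD.sdiff hK) ?_ ?_ hF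
  · rw [contourIntegral_append, contourIntegral_reverse, ← sub_eq_add_neg, sub_eq_zero] at h
    exact h
  · rw [trace_append]
    exact union_subset hΓ.trace_subset' ((trace_reverse_subset Γ').trans
      (hΓ'.trace_subset'.trans (sdiff_subset_sdiff_right hKK')))
  · intro w hw
    rw [windingNumber_append, windingNumber_reverse]
    -- Points of `K' \ K` lie in `D \ K`, so the winding number of `Γ` about them, which is not
    -- prescribed, never matters.
    by_cases hwD : w ∈ D
    · have hwK : w ∈ K := by
        by_contra hwK
        exact hw ⟨hwD, hwK⟩
      rw [hΓ.winding_eq_one w hwK, hΓ'.winding_eq_one w (hKK' hwK), add_neg_cancel]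
    · rw [hΓ.winding_eq_zero w hwD, hΓ'.winding_eq_zero w hwD, neg_zero, add_zero]

/-! ### Existence of surrounding contours. -/

/-- The counterclockwise circle with centre `c` and radius `R`. -/
def circle (c : ℂ) (R : ℝ) : ClosedCurve where
  toFun t := circleMap c R (2 * Real.pi * t)
  continuousOn := by
    have := continuous_circleMap c R
    fun_prop
  closed := by simp [circleMap]
  piecewise := by
    refine ⟨∅, fun t _ _ => ContDiff.contDiffAt ?_⟩
    have := contDiff_circleMap c R (n := 1)
    exact this.comp (by fun_prop)
  integrable := by
    have h : ContDiff ℝ 1 fun t : ℝ => circleMap c R (2 * Real.pi * t) :=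
      (contDiff_circleMap c R).comp (by fun_prop)
    exact (h.continuous_deriv le_rfl).intervalIntegrable _ _

theorem contourIntegral_circle (c : ℂ) (R : ℝ) (F : ℂ → E) :
    contourIntegral [circle c R] F = ∮ z in C(c, R), F z := by
  have hd : ∀ t : ℝ, deriv (circle c R).toFun t =
      (2 * Real.pi : ℝ) • deriv (circleMap c R) (2 * Real.pi * t) := fun t => by
    exact deriv_comp_mul_left (2 * Real.pi) (circleMap c R) t
  simp only [contourIntegral, List.map_cons, List.map_nil, List.sum_cons, List.sum_nil, add_zero,
    hd, circleIntegral, smul_assoc]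
  rw [intervalIntegral.integral_smul]
  have h := intervalIntegral.smul_integral_comp_mul_left (a := 0) (b := 1)
    (fun θ => deriv (circleMap c R) θ • F (circleMap c R θ)) (2 * Real.pi)
  simp only [mul_zero, mul_one] at h
  exact h

theorem windingNumber_circle_of_mem {c w : ℂ} {R : ℝ} (hw : w ∈ Metric.ball c R) :
    windingNumber [circle c R] w = 1 := by
  rw [windingNumber, contourIntegral_circle, circleIntegral.integral_sub_inv_of_mem_ball hw]
  exact inv_mul_cancel₀ Complex.two_pi_I_ne_zero

theorem windingNumber_circle_of_notMem {c w : ℂ} {R : ℝ} (hR : 0 ≤ R)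
    (hw : w ∉ Metric.closedBall c R) : windingNumber [circle c R] w = 0 := by
  rw [windingNumber, contourIntegral_circle,
    Complex.circleIntegral_eq_zero_of_differentiable_on_off_countable hR countable_empty
      (continuousOn_inv_sub hw) fun z hz => ?_, mul_zero]
  refine DifferentiableAt.inv (by fun_prop) (sub_ne_zero.mpr fun h => hw (h ▸ ?_))
  exact Metric.ball_subset_closedBall hz.1

theorem circle_mem_sphere (c : ℂ) {R : ℝ} (hR : 0 ≤ R) (t : ℝ) :
    (circle c R).toFun t ∈ Metric.sphere c R :=
  circleMap_mem_sphere c hR _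

theorem exists_surrounds_univ {K : Set ℂ} (hK : IsCompact K) :
    ∃ Γ : Contour, Surrounds Γ univ K := by
  obtain ⟨R, hR, hKR⟩ := hK.isBounded.subset_ball_lt 0 0
  refine ⟨[circle 0 R], ?_, fun w hw => windingNumber_circle_of_mem (hKR hw), by simp⟩
  intro γ hγ t _
  rw [List.mem_singleton.mp hγ]
  refine ⟨mem_univ _, fun h => ?_⟩
  exact Metric.sphere_disjoint_ball.le_bot ⟨circle_mem_sphere 0 hR.le t, hKR h⟩

theorem isOpen_greenDomain : IsOpen greenDomain :=
  isOpen_ne_fun Complex.continuous_re continuous_const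

/-- A compact set off the imaginary axis is covered by two discs on either side of the axis. -/
theorem exists_balls {K : Set ℂ} (hK : IsCompact K) (hre : ∀ z ∈ K, z.re ≠ 0) :
    ∃ c r : ℝ, 0 < r ∧ r < c ∧
      ∀ z ∈ K, (0 < z.re → z ∈ Metric.ball (c : ℂ) r) ∧
        (z.re < 0 → z ∈ Metric.ball (-c : ℂ) r) := by
  obtain ⟨δ, hδ, hKδ⟩ : ∃ δ > 0, ∀ z ∈ K, δ ≤ |z.re| := by
    obtain rfl | hne := K.eq_empty_or_nonempty
    · exact ⟨1, one_pos, by simp⟩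
    · obtain ⟨z, hz, hmin⟩ := hK.exists_isMinOn hne
        (Complex.continuous_re.abs.continuousOn (s := K))
      exact ⟨|z.re|, abs_pos.mpr (hre z hz), fun w hw => hmin hw⟩
  obtain ⟨M, hM⟩ := hK.isBounded.exists_norm_le
  -- If `x ≥ δ` and `x² + y² ≤ M²`, then `(x - c)² + y² ≤ M² - 2cδ + c²`. This is less than `(c -
  -- δ/2)²` once `cδ > M²`; the summand `δ + 1` keeps the radius `c - δ/2` positive.
  set c : ℝ := M ^ 2 / δ + δ + 1 with hc
  have hcδ : M ^ 2 < c * δ := by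
    have : c * δ = M ^ 2 + (δ + 1) * δ := by
      rw [hc]
      field_simp
      ring
    nlinarith
  have hcpos : δ + 1 ≤ c := by
    have : 0 ≤ M ^ 2 / δ := by positivity
    linarith
  have key : ∀ x y : ℝ, δ ≤ x → x ^ 2 + y ^ 2 ≤ M ^ 2 →
      (x - c) ^ 2 + y ^ 2 < (c - δ / 2) ^ 2 := fun x y hx hxy => by nlinarith
  have hnorm : ∀ z ∈ K, z.re ^ 2 + z.im ^ 2 ≤ M ^ 2 := fun z hz => by
    have h1 := hM z hz
    have h2 := Complex.sq_norm z
    rw [Complex.normSq_apply] at h2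
    have := pow_le_pow_left₀ (norm_nonneg z) h1 2
    nlinarith
  have hr : 0 < c - δ / 2 := by linarith
  have hball : ∀ z w : ℂ, (z.re - w.re) ^ 2 + (z.im - w.im) ^ 2 < (c - δ / 2) ^ 2 →
      z ∈ Metric.ball w (c - δ / 2) := fun z w h => by
    rw [Metric.mem_ball, dist_eq_norm]
    refine lt_of_pow_lt_pow_left₀ 2 hr.le ?_
    rw [Complex.sq_norm, Complex.normSq_apply, Complex.sub_re, Complex.sub_im]
    linarith
  refine ⟨c, c - δ / 2, hr, by linarith, fun z hz => ⟨fun h => ?_, fun h => ?_⟩⟩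
  · refine hball _ _ ?_
    have h1 := hKδ z hz
    rw [abs_of_pos h] at h1
    simpa using key _ _ h1 (hnorm z hz)
  · refine hball _ _ ?_
    have h1 := hKδ z hz
    rw [abs_of_neg h] at h1
    have := key (-z.re) z.im h1 (by simpa using hnorm z hz)
    simp only [Complex.neg_re, Complex.ofReal_re, Complex.neg_im, Complex.ofReal_im]
    linarith

theorem exists_surrounds_greenDomain {K : Set ℂ} (hK : IsCompact K) (hre : ∀ z ∈ K, z.re ≠ 0) :
    ∃ Γ : Contour, Surrounds Γ greenDomain K := by
  obtain ⟨c, r, hr, hrc, hball⟩ := exists_balls hK hre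
  have hpos : ∀ z ∈ Metric.closedBall (c : ℂ) r, 0 < z.re := fun z hz => by
    rw [Metric.mem_closedBall, dist_eq_norm] at hz
    have := (Complex.abs_re_le_norm _).trans hz
    rw [Complex.sub_re, Complex.ofReal_re, abs_le] at this
    linarith
  have hneg : ∀ z ∈ Metric.closedBall (-c : ℂ) r, z.re < 0 := fun z hz => by
    rw [Metric.mem_closedBall, dist_eq_norm] at hz
    have := (Complex.abs_re_le_norm _).trans hz
    rw [Complex.sub_re, Complex.neg_re, Complex.ofReal_re, abs_le] at this
    linarith
  have hsplit : ∀ w, windingNumber [circle c r, circle (-c) r] w =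
      windingNumber [circle c r] w + windingNumber [circle (-c) r] w := fun w =>
    windingNumber_append [circle c r] [circle (-c) r] w
  refine ⟨[circle c r, circle (-c) r], ?_, fun w hw => ?_, fun w hw => ?_⟩
  · intro γ hγ t _
    have hdisj : ∀ a : ℂ, (circle a r).toFun t ∉ Metric.ball a r := fun a h =>
      Metric.sphere_disjoint_ball.le_bot ⟨circle_mem_sphere a hr.le t, h⟩
    have hcl : ∀ a : ℂ, (circle a r).toFun t ∈ Metric.closedBall a r := fun a =>
      Metric.sphere_subset_closedBall (circle_mem_sphere a hr.le t)
    rcases List.mem_pair.mp hγ with rfl | rfl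
    · have := hpos _ (hcl c)
      exact ⟨this.ne', fun h => hdisj c ((hball _ h).1 this)⟩
    · have := hneg _ (hcl (-c))
      exact ⟨this.ne, fun h => hdisj (-c) ((hball _ h).2 this)⟩
  · rw [hsplit]
    rcases lt_or_gt_of_ne (hre w hw) with h | h
    · rw [windingNumber_circle_of_mem ((hball w hw).2 h),
        windingNumber_circle_of_notMem hr.le fun h' => (hpos w h').not_gt h, zero_add]
    · rw [windingNumber_circle_of_mem ((hball w hw).1 h),
        windingNumber_circle_of_notMem hr.le fun h' => (hneg w h').not_gt h, add_zero]
  · have hw0 : w.re = 0 := not_not.mp hw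
    rw [hsplit, windingNumber_circle_of_notMem hr.le fun h' => (hpos w h').ne' hw0,
      windingNumber_circle_of_notMem hr.le fun h' => (hneg w h').ne hw0, add_zero]

/-! ### Resolvents. -/

section Resolvent

variable {R : Type*} [Ring R] [Algebra ℂ R]

theorem sub_mul_resolvent {a : R} {z : ℂ} (h : z ∉ spectrum ℂ a) :
    (algebraMap ℂ R z - a) * resolvent a z = 1 :=
  Ring.mul_inverse_cancel _ (spectrum.notMem_iff.mp h)

theorem resolvent_mul_sub {a : R} {z : ℂ} (h : z ∉ spectrum ℂ a) :
    resolvent a z * (algebraMap ℂ R z - a) = 1 :=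
  Ring.inverse_mul_cancel _ (spectrum.notMem_iff.mp h)

/-- Used to transport resolvents between algebras: from causal operators to all operators, and from
an operator to its diagonal blocks. -/
theorem resolvent_eq_of_mul_eq_one {a b : R} {z : ℂ} (h₁ : (algebraMap ℂ R z - a) * b = 1)
    (h₂ : b * (algebraMap ℂ R z - a) = 1) : z ∉ spectrum ℂ a ∧ resolvent a z = b := by
  have hz : z ∈ resolventSet ℂ a := spectrum.mem_resolventSet_of_left_right_inverse h₁ h₂
  refine ⟨not_not.mpr hz, ?_⟩
  exact left_inv_eq_right_inv (resolvent_mul_sub (not_not.mpr hz)) h₁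

theorem differentiableOn_resolvent {B : Type*} [NormedRing B] [NormedAlgebra ℂ B]
    [CompleteSpace B] (a : B) : DifferentiableOn ℂ (resolvent a) (spectrum ℂ a)ᶜ := fun _ hz =>
  (spectrum.hasDerivAt_resolvent_const_left
    (not_not.mp hz)).differentiableAt.differentiableWithinAt

theorem continuousOn_resolvent_clm {Y : Type*} [NormedAddCommGroup Y] [NormedSpace ℂ Y]
    [CompleteSpace Y] (T : Y →L[ℂ] Y) : ContinuousOn (resolvent T) (spectrum ℂ T)ᶜ :=
  (differentiableOn_resolvent T).continuousOn

theorem continuousOn_comp_comp {Y₁ Y₂ Y₃ Y₄ : Type*} [NormedAddCommGroup Y₁] [NormedSpace ℂ Y₁]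
    [NormedAddCommGroup Y₂] [NormedSpace ℂ Y₂] [NormedAddCommGroup Y₃] [NormedSpace ℂ Y₃]
    [NormedAddCommGroup Y₄] [NormedSpace ℂ Y₄] {s : Set ℂ} {P : ℂ → Y₃ →L[ℂ] Y₄}
    (L : Y₂ →L[ℂ] Y₃) {Q : ℂ → Y₁ →L[ℂ] Y₂} (hP : ContinuousOn P s) (hQ : ContinuousOn Q s) :
    ContinuousOn (fun z => P z ∘L L ∘L Q z) s :=
  hP.clm_comp (continuousOn_const.clm_comp hQ)

end Resolvent

/-! ### Sums over chains. -/

/-- A chain either consists of a single index, or is a chain prolonged by a larger index. -/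
def chainEquiv {n : ℕ} (i j : Fin n) :
    Chain i j ≃ PLift (i = j) ⊕ (Σ k : {k : Fin n // k < i}, Chain k.1 j) where
  toFun c := match c with
    | .single _ => Sum.inl ⟨rfl⟩
    | .cons _ (k := k) h c => Sum.inr ⟨⟨k, h⟩, c⟩
  invFun s := match s with
    | Sum.inl h => h.down ▸ Chain.single i
    | Sum.inr p => Chain.cons i p.1.2 p.2
  left_inv c := by cases c <;> rfl
  right_inv s := by
    rcases s with ⟨⟨rfl⟩⟩ | p <;> rfl

theorem sum_chain_self {n : ℕ} {M : Type*} [AddCommMonoid M] (i : Fin n) (f : Chain i i → M) :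
    ∑ c, f c = f (.single i) + ∑ k : {k : Fin n // k < i}, ∑ c : Chain k.1 i, f (.cons i k.2 c) := by
  rw [← (chainEquiv i i).symm.sum_comp, Fintype.sum_sum_type, Fintype.sum_sigma]
  congr 1
  rw [Fintype.sum_subsingleton _ ⟨rfl⟩]
  rfl

theorem sum_chain_of_ne {n : ℕ} {M : Type*} [AddCommMonoid M] {i j : Fin n} (h : i ≠ j)
    (f : Chain i j → M) :
    ∑ c, f c = ∑ k : {k : Fin n // k < i}, ∑ c : Chain k.1 j, f (.cons i k.2 c) := by
  have : IsEmpty (PLift (i = j)) := ⟨fun p => h p.down⟩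
  rw [← (chainEquiv i j).symm.sum_comp, Fintype.sum_sum_type, Fintype.sum_sigma]
  simp only [Finset.univ_eq_empty, Finset.sum_empty, zero_add]
  rfl

/-! ### Operator matrices, causal spectrum and the chain expansion. -/

namespace Decomposition

variable {X : Type*} [NormedAddCommGroup X] [NormedSpace ℂ X] [CompleteSpace X] {n : ℕ}
  (V : Decomposition X n)

theorem completeSpace (i : Fin n) : CompleteSpace (V.space i) :=
  (V.isClosed i).completeSpace_coe

/-- The entry `T_{ij}` of the operator matrix as a bounded linear function of `T`. -/
def blockCLM (i j : Fin n) : (X →L[ℂ] X) →L[ℂ] (V.space j →L[ℂ] V.space i) :=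
  ContinuousLinearMap.compL ℂ (V.space j) X (V.space i) (V.component i) ∘L
    (ContinuousLinearMap.compL ℂ (V.space j) X X).flip (V.space j).subtypeL

theorem blockCLM_apply (i j : Fin n) (T : X →L[ℂ] X) : V.blockCLM i j T = V.block T i j := rfl

theorem block_sub (S T : X →L[ℂ] X) (i j : Fin n) :
    V.block (S - T) i j = V.block S i j - V.block T i j :=
  map_sub (V.blockCLM i j) S T

theorem block_algebraMap_self (z : ℂ) (i : Fin n) :
    V.block (algebraMap ℂ (X →L[ℂ] X) z) i i = algebraMap ℂ (V.space i →L[ℂ] V.space i) z := by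
  ext x
  have h := V.component_apply (Pi.single i x) i
  have hx : ∑ k, ((Pi.single i x : (k : Fin n) → V.space k) k : X) = x := by
    rw [Finset.sum_eq_single i]
    · simp
    · intro k _ hk
      simp [Pi.single_eq_of_ne hk]
    · simp
  rw [hx, Pi.single_eq_same] at h
  simp [block, Algebra.algebraMap_eq_smul_one, h]

theorem block_algebraMap_of_ne (z : ℂ) {i j : Fin n} (h : i ≠ j) :
    V.block (algebraMap ℂ (X →L[ℂ] X) z) i j = 0 := by
  ext x
  simp [block, Algebra.algebraMap_eq_smul_one, V.component_of_ne h x]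

theorem block_one_self (i : Fin n) : V.block 1 i i = 1 := by
  rw [← map_one (algebraMap ℂ _), block_algebraMap_self, map_one]

theorem block_one_of_ne {i j : Fin n} (h : i ≠ j) : V.block 1 i j = 0 := by
  rw [← map_one (algebraMap ℂ _), block_algebraMap_of_ne V 1 h]

theorem block_of_mem_causal {T : X →L[ℂ] X} (hT : T ∈ V.causal) {i j : Fin n} (h : i < j) :
    V.block T i j = 0 := hT i j h

/-- For `k ≠ i` one of the entries `S_ik`, `T_ki` lies above the diagonal. -/
theorem block_mul_self {S T : X →L[ℂ] X} (hS : S ∈ V.causal) (hT : T ∈ V.causal) (i : Fin n) :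
    V.block (S * T) i i = V.block S i i * V.block T i i := by
  rw [block_mul, Finset.sum_eq_single i]
  · rfl
  · intro k _ hk
    rcases lt_or_gt_of_ne hk with h | h
    · rw [V.block_of_mem_causal hT h, ContinuousLinearMap.comp_zero]
    · rw [V.block_of_mem_causal hS h, ContinuousLinearMap.zero_comp]
  · simp

/-- Makes the causal operators a Banach algebra, as needed for compactness of `σ⁺(A)` and for its
comparison with `σ(A)`. -/
theorem isClosed_causal : IsClosed (V.causal : Set (X →L[ℂ] X)) := by
  have h : (V.causal : Set (X →L[ℂ] X)) =
      ⋂ (i : Fin n) (j : Fin n) (_ : i < j), V.blockCLM i j ⁻¹' {0} := by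
    ext T
    simp only [mem_iInter, mem_preimage, mem_singleton_iff, blockCLM_apply]
    rfl
  rw [h]
  exact isClosed_iInter fun i => isClosed_iInter fun j => isClosed_iInter fun _ =>
    isClosed_singleton.preimage (V.blockCLM i j).continuous

theorem ordinarySpectrum_subset (A : V.causal) : V.ordinarySpectrum A ⊆ V.causalSpectrum A :=
  spectrum.subset_subalgebra A

theorem isCompact_causalSpectrum (A : V.causal) : IsCompact (V.causalSpectrum A) := by
  have : CompleteSpace V.causal := V.isClosed_causal.completeSpace_coe
  exact spectrum.isCompact (𝕜 := ℂ) (A := V.causal) A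

theorem isCompact_ordinarySpectrum (A : V.causal) : IsCompact (V.ordinarySpectrum A) :=
  spectrum.isCompact (A : X →L[ℂ] X)

/-- If the ordinary spectrum misses the imaginary axis, so does the causal spectrum. -/
theorem re_ne_zero_of_mem_causalSpectrum {A : V.causal}
    (h : ∀ z ∈ V.ordinarySpectrum A, z.re ≠ 0) : ∀ z ∈ V.causalSpectrum A, z.re ≠ 0 := by
  intro z hz hre
  have : IsClosed (V.causal : Set (X →L[ℂ] X)) := V.isClosed_causal
  -- A point of `σ⁺(A)` has a bounded component in the complement of `σ(A)`, but the component of a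
  -- point on the axis would contain the whole axis.
  have hb := Subalgebra.spectrum_isBounded_connectedComponentIn (𝕜 := ℂ) V.causal A hz
  have hsub : {w : ℂ | w.re = 0} ⊆ connectedComponentIn (spectrum ℂ (A : X →L[ℂ] X))ᶜ z := by
    refine IsPreconnected.subset_connectedComponentIn ?_ hre fun w hw hw' => h w hw' hw
    exact (convex_hyperplane (𝕜 := ℝ) Complex.reLm.isLinear 0).isPreconnected
  obtain ⟨C, hC⟩ := (hb.subset hsub).exists_norm_le
  have h1 := hC (((|C| + 1 : ℝ) : ℂ) * Complex.I) (by simp)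
  rw [norm_mul, Complex.norm_I, mul_one, Complex.norm_real, Real.norm_of_nonneg (by positivity)]
    at h1
  linarith [le_abs_self C]

section CausalResolvent

variable {V} {A : V.causal} {z : ℂ}

/-- The inverse in the subalgebra is also the inverse among all bounded operators. -/
theorem resolvent_mem_causal (hz : z ∉ V.causalSpectrum A) :
    resolvent (A : X →L[ℂ] X) z ∈ V.causal := by
  have h := resolvent_eq_of_mul_eq_one (a := (A : X →L[ℂ] X)) (b := (resolvent A z : V.causal))
    (congrArg Subtype.val (sub_mul_resolvent hz)) (congrArg Subtype.val (resolvent_mul_sub hz))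
  rw [h.2]
  exact (resolvent A z).2

theorem sub_mem_causal (A : V.causal) (z : ℂ) :
    algebraMap ℂ (X →L[ℂ] X) z - (A : X →L[ℂ] X) ∈ V.causal :=
  (algebraMap ℂ V.causal z - A).2

/-- The diagonal entries of the resolvent are the resolvents of the diagonal entries. -/
theorem resolvent_block_self (hz : z ∉ V.causalSpectrum A) (i : Fin n) :
    z ∉ spectrum ℂ (V.block (A : X →L[ℂ] X) i i) ∧
      resolvent (V.block (A : X →L[ℂ] X) i i) z = V.block (resolvent (A : X →L[ℂ] X) z) i i := by
  have hz' : z ∉ spectrum ℂ (A : X →L[ℂ] X) := fun h => hz (V.ordinarySpectrum_subset A h)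
  have hb : V.block (algebraMap ℂ (X →L[ℂ] X) z - (A : X →L[ℂ] X)) i i =
      algebraMap ℂ (V.space i →L[ℂ] V.space i) z - V.block (A : X →L[ℂ] X) i i := by
    rw [block_sub, block_algebraMap_self]
  refine resolvent_eq_of_mul_eq_one ?_ ?_
  · rw [← hb, ← block_mul_self V (sub_mem_causal A z) (resolvent_mem_causal hz),
      sub_mul_resolvent hz', block_one_self]
  · rw [← hb, ← block_mul_self V (resolvent_mem_causal hz) (sub_mem_causal A z),
      resolvent_mul_sub hz', block_one_self]

/-- Forward substitution for the entries of the resolvent. -/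
theorem block_resolvent_eq (hz : z ∉ V.causalSpectrum A) (i j : Fin n) :
    V.block (resolvent (A : X →L[ℂ] X) z) i j =
      resolvent (V.block (A : X →L[ℂ] X) i i) z ∘L (V.block 1 i j +
        ∑ k : {k : Fin n // k < i}, V.block (A : X →L[ℂ] X) i k ∘L
          V.block (resolvent (A : X →L[ℂ] X) z) k j) := by
  set B : X →L[ℂ] X := (A : X →L[ℂ] X)
  set S := resolvent B z
  have hz' : z ∉ spectrum ℂ B := fun h => hz (V.ordinarySpectrum_subset A h)
  have h1 := V.block_mul (algebraMap ℂ (X →L[ℂ] X) z - B) S i j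
  rw [sub_mul_resolvent hz', ← Finset.add_sum_erase _ _ (Finset.mem_univ i)] at h1
  -- In row `i` of `(z - A) S = 1` the off-diagonal coefficients are `-A_ik` for `k < i` and zero
  -- for `k > i`.
  have h2 : ∑ k ∈ Finset.univ.erase i, V.block (algebraMap ℂ (X →L[ℂ] X) z - B) i k ∘L
      V.block S k j = -∑ k : {k : Fin n // k < i}, V.block B i k ∘L V.block S k j := by
    rw [← Finset.sum_subtype (Finset.univ.filter (· < i)) (by simp)
      (fun k => V.block B i k ∘L V.block S k j), ← Finset.sum_neg_distrib]
    symm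
    refine Finset.sum_subset_zero_on_sdiff ?_ ?_ ?_
    · intro k hk
      simpa using (Finset.mem_filter.mp hk).2.ne
    · intro k hk
      simp only [Finset.mem_sdiff, Finset.mem_erase, Finset.mem_univ, and_true,
        Finset.mem_filter, true_and, not_lt] at hk
      rw [V.block_of_mem_causal (sub_mem_causal A z) (lt_of_le_of_ne hk.2 hk.1.symm),
        ContinuousLinearMap.zero_comp]
    · intro k hk
      rw [block_sub, block_algebraMap_of_ne V z (Finset.mem_filter.mp hk).2.ne', zero_sub,
        ContinuousLinearMap.neg_comp]
  rw [h2, ← sub_eq_add_neg, eq_sub_iff_add_eq, block_sub, block_algebraMap_self] at h1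
  rw [h1, ← ContinuousLinearMap.comp_assoc]
  have h3 : resolvent (V.block B i i) z ∘L
      (algebraMap ℂ (V.space i →L[ℂ] V.space i) z - V.block B i i) = 1 :=
    resolvent_mul_sub (resolvent_block_self hz i).1
  rw [h3]
  rfl

/-- Strong induction on `i`: forward substitution and the splitting of a chain at its first index
are the same recursion. -/
theorem block_resolvent_eq_sum (hz : z ∉ V.causalSpectrum A) (j : Fin n) : ∀ i : Fin n,
    V.block (resolvent (A : X →L[ℂ] X) z) i j =
      ∑ c : Chain i j, V.resolventProduct (A : X →L[ℂ] X) z c := by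
  intro i
  induction i using WellFoundedLT.induction with
  | ind i ih =>
    have hs : ∑ k : {k : Fin n // k < i}, V.block (A : X →L[ℂ] X) i k ∘L
        V.block (resolvent (A : X →L[ℂ] X) z) k j =
        ∑ k : {k : Fin n // k < i}, ∑ c : Chain k.1 j,
          V.block (A : X →L[ℂ] X) i k ∘L V.resolventProduct (A : X →L[ℂ] X) z c := by
      refine Finset.sum_congr rfl fun k _ => ?_
      rw [ih k.1 k.2, ContinuousLinearMap.comp_finsetSum]
    rw [block_resolvent_eq hz, hs, ContinuousLinearMap.comp_add,
      ContinuousLinearMap.comp_finsetSum]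
    simp only [ContinuousLinearMap.comp_finsetSum]
    by_cases hij : i = j
    · subst hij
      rw [sum_chain_self, block_one_self]
      rfl
    · rw [sum_chain_of_ne hij, block_one_of_ne V hij, ContinuousLinearMap.comp_zero, zero_add]
      rfl

end CausalResolvent

/-- Continuity suffices, because the products are only integrated termwise over the fixed contour
`Γ'`. -/
theorem continuousOn_resolventProduct (A : V.causal) {i j : Fin n} (c : Chain i j) :
    ContinuousOn (fun z => V.resolventProduct (A : X →L[ℂ] X) z c) (V.causalSpectrum A)ᶜ := by
  have hres : ∀ i, ContinuousOn (resolvent (V.block (A : X →L[ℂ] X) i i))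
      (V.causalSpectrum A)ᶜ := fun i => by
    have := V.completeSpace i
    exact (continuousOn_resolvent_clm (V.block (A : X →L[ℂ] X) i i)).mono fun z hz =>
      (resolvent_block_self hz i).1
  induction c with
  | single i => exact hres i
  | cons i h c ih => exact continuousOn_comp_comp (V.block (A : X →L[ℂ] X) _ _) (hres i) ih

theorem block_functionOfOperator {f : ℂ → ℂ} {Γ : Contour} {A : X →L[ℂ] X}
    (h : ContinuousOn (fun z => f z • resolvent A z) (trace Γ)) (i j : Fin n) :
    V.block (functionOfOperator f Γ A) i j = (2 * (Real.pi : ℂ) * Complex.I)⁻¹ •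
      contourIntegral Γ fun z => f z • V.block (resolvent A z) i j := by
  have := V.completeSpace i
  have h1 := contourIntegral_clm (E := X →L[ℂ] X) (E' := V.space j →L[ℂ] V.space i)
    (V.blockCLM i j) h
  simp only [map_smul, blockCLM_apply] at h1
  rw [h1, functionOfOperator, ← blockCLM_apply, map_smul, blockCLM_apply]

/-- The matrix of an analytic function of a causal operator. -/
theorem block_functionOfOperator_eq {D : Set ℂ} (hD : IsOpen D) {f : ℂ → ℂ}
    (hf : DifferentiableOn ℂ f D) {A : V.causal} {Γ Γ' : Contour}
    (hΓ : Surrounds Γ D (V.ordinarySpectrum A)) (hΓ' : Surrounds Γ' D (V.causalSpectrum A))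
    (i j : Fin n) :
    (i < j → V.block (functionOfOperator f Γ A) i j = 0) ∧
      (j ≤ i → V.block (functionOfOperator f Γ A) i j =
        ∑ c : Chain i j, V.dividedDifference f Γ' A c) := by
  have hF : DifferentiableOn ℂ (fun z => f z • resolvent (A : X →L[ℂ] X) z)
      (D \ V.ordinarySpectrum A) :=
    (hf.mono sdiff_subset).smul
      ((differentiableOn_resolvent _).mono fun z hz => hz.2)
  -- The contour is changed before blocks are taken: `Γ` may meet `σ⁺(A) \ σ(A)`, where the
  -- resolvent need not be triangular.
  have hΓΓ' : functionOfOperator f Γ (A : X →L[ℂ] X) = functionOfOperator f Γ' A := by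
    rw [functionOfOperator, functionOfOperator, hΓ.contourIntegral_eq hD
      (V.isCompact_ordinarySpectrum A).isClosed (V.ordinarySpectrum_subset A) hΓ' hF]
  have htr : trace Γ' ⊆ D \ V.ordinarySpectrum A := hΓ'.trace_subset'.trans
    (sdiff_subset_sdiff_right (V.ordinarySpectrum_subset A))
  have hmem : ∀ z ∈ trace Γ', z ∉ V.causalSpectrum A := fun z hz => (hΓ'.trace_subset' hz).2
  rw [hΓΓ', V.block_functionOfOperator (hF.continuousOn.mono htr)]
  refine ⟨fun hij => ?_, fun _ => ?_⟩
  · rw [contourIntegral_congr (G := fun _ => 0) fun z hz => ?_, contourIntegral_zero]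
    · exact smul_zero (A := V.space j →L[ℂ] V.space i) (_ : ℂ)
    rw [V.block_of_mem_causal (resolvent_mem_causal (hmem z hz)) hij]
    exact smul_zero (A := V.space j →L[ℂ] V.space i) (f z)
  · unfold dividedDifference
    rw [← Finset.smul_sum, ← contourIntegral_sum]
    · congr 1
      refine contourIntegral_congr fun z hz => ?_
      rw [block_resolvent_eq_sum (hmem z hz), Finset.smul_sum]
    · exact fun c _ => (hf.continuousOn.mono fun z hz => (htr hz).1).smul
        ((V.continuousOn_resolventProduct A c).mono hmem)

end Decomposition

/-! ### Analyticity of the three functions, and the theorem. -/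

theorem differentiable_expPlus (t : ℝ) : Differentiable ℂ (expPlus t) := by
  unfold expPlus
  split_ifs <;> fun_prop

theorem differentiable_expMinus (t : ℝ) : Differentiable ℂ (expMinus t) := by
  unfold expMinus
  split_ifs <;> fun_prop

theorem differentiableOn_green (t : ℝ) : DifferentiableOn ℂ (green t) greenDomain := by
  intro z hz
  refine DifferentiableAt.differentiableWithinAt ?_
  rcases lt_or_gt_of_ne hz with h | h
  · refine (differentiable_expPlus t z).congr_of_eventuallyEq ?_
    filter_upwards [(isOpen_lt Complex.continuous_re continuous_const).mem_nhds h] with w hw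
    exact if_neg (not_lt.mpr (le_of_lt hw))
  · refine (differentiable_expMinus t z).congr_of_eventuallyEq ?_
    filter_upwards [(isOpen_lt continuous_const Complex.continuous_re).mem_nhds h] with w hw
    exact if_pos hw

end BlockTri

end

open BlockTri in
theorem theoremt {X : Type*} [NormedAddCommGroup X] [NormedSpace ℂ X] [CompleteSpace X] {n : ℕ}
    (V : Decomposition X n) (A : V.causal) (t : ℝ) (ht : t ≠ 0) :
    -- contours for `exp_{±,t}(A)` and for its divided differences exist
    ((∃ Γ : Contour, Surrounds Γ Set.univ (V.ordinarySpectrum A)) ∧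
      (∃ Γ : Contour, Surrounds Γ Set.univ (V.causalSpectrum A)) ∧
      -- whatever the choice of the contours, the blocks have the asserted form
      ∀ Γ Γ' : Contour, Surrounds Γ Set.univ (V.ordinarySpectrum A) →
        Surrounds Γ' Set.univ (V.causalSpectrum A) → ∀ i j : Fin n,
          (i < j → V.block (functionOfOperator (expPlus t) Γ A) i j = 0) ∧
          (j ≤ i → V.block (functionOfOperator (expPlus t) Γ A) i j =
            ∑ c : Chain i j, V.dividedDifference (expPlus t) Γ' A c) ∧
          (i < j → V.block (functionOfOperator (expMinus t) Γ A) i j = 0) ∧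
          (j ≤ i → V.block (functionOfOperator (expMinus t) Γ A) i j =
            ∑ c : Chain i j, V.dividedDifference (expMinus t) Γ' A c)) ∧
    -- the same for `g_t`, if the ordinary spectrum misses the imaginary axis
    ((∀ z ∈ V.ordinarySpectrum A, z.re ≠ 0) →
      (∃ Γ : Contour, Surrounds Γ greenDomain (V.ordinarySpectrum A)) ∧
      (∃ Γ : Contour, Surrounds Γ greenDomain (V.causalSpectrum A)) ∧
      ∀ Γ Γ' : Contour, Surrounds Γ greenDomain (V.ordinarySpectrum A) →
        Surrounds Γ' greenDomain (V.causalSpectrum A) → ∀ i j : Fin n,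
          (i < j → V.block (functionOfOperator (green t) Γ A) i j = 0) ∧
          (j ≤ i → V.block (functionOfOperator (green t) Γ A) i j =
            ∑ c : Chain i j, V.dividedDifference (green t) Γ' A c)) := by
  refine ⟨⟨exists_surrounds_univ (V.isCompact_ordinarySpectrum A),
    exists_surrounds_univ (V.isCompact_causalSpectrum A), fun Γ Γ' hΓ hΓ' i j => ?_⟩,
    fun h => ⟨exists_surrounds_greenDomain (V.isCompact_ordinarySpectrum A) h,
      exists_surrounds_greenDomain (V.isCompact_causalSpectrum A)
        (V.re_ne_zero_of_mem_causalSpectrum h), fun Γ Γ' hΓ hΓ' i j => ?_⟩⟩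
  · have hp := V.block_functionOfOperator_eq isOpen_univ
      (differentiable_expPlus t).differentiableOn hΓ hΓ' i j
    have hm := V.block_functionOfOperator_eq isOpen_univ
      (differentiable_expMinus t).differentiableOn hΓ hΓ' i j
    exact ⟨hp.1, hp.2, hm.1, hm.2⟩
  · exact V.block_functionOfOperator_eq isOpen_greenDomain (differentiableOn_green t) hΓ hΓ' i j
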